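/- Throughout, $n,r$ are integers with $3\le r\le n-3$, $\boldsymbol d=(d_1,\dots,d_n)$ is a sequence of positive integers such that $r$ divides $\sum_{j}d_j$, $d=\frac1n\sum_j d_j$ is the average degree and $e(\boldsymbol d)=\frac1r\sum_j d_j$. The pair $(r,\boldsymbol d)$ is in the first quadrant if $r\le n/2$ and $e(\boldsymbol d)\le\frac12\binom nr$. A vector $\boldsymbol\beta\in\mathbb R^n$ solves the beta-system for $(r,\boldsymbol d)$ if $$\sum_{\substack{W\subseteq[n],\ |W|=r\\ j\in W}}\lambda_W(\boldsymbol\beta)=d_j\quad\text{for all } j\in[n],\qquad\text{where}\quad \lambda_W(\boldsymbol\beta)=\frac{e^{\sum_{k\in W}\beta_k}}{1+e^{\sum_{k\in W}\beta_k}}.$$ **Lemma 1.3.** (i) There are absolute constants $\Delta_0>0$ and $K>0$ such that, for all $n$, $r$, $\boldsymbol d$ as above with $(r,\boldsymbol d)$ in the first quadrant and all real $\Delta$ with $0\le\Delta\le\Delta_0$: if $d e^{-\Delta/r}\le d_j\le d e^{\Delta/r}$ for all $j\in[n]$, then the beta-system has a solution $\boldsymbol\beta^\ast$ with $\max_{j,k\in[n]}|\beta^\ast_j-\beta^\ast_k|\le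 K\Delta/r$. (ii) The same conclusion, with an implicit constant, holds when $rd=o\bigl(\binom{n-1}{r-1}\bigr)$, $r=o(n)$ and $\Delta=\Theta(1)$. Explicitly: for all constants $0<c\le C$ there are $\varepsilon>0$ and $K>0$, depending only on $c$ and $C$, such that, for all $n$, $r$, $\boldsymbol d$ as above with $(r,\boldsymbol d)$ in the first quadrant and all real $\Delta$ with $c\le\Delta\le C$: if $rd\le\varepsilon\binom{n-1}{r-1}$, $r\le\varepsilon n$, and $d e^{-\Delta/r}\le d_j\le d e^{\Delta/r}$ for all $j\in[n]$, then the beta-system has a solution $\boldsymbol\beta^\ast$ with $\max_{j,k\in[n]}|\beta^\ast_j-\beta^\ast_k|\le K\Delta/r$. -/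

import Mathlib

open Finset

namespace HypergraphDegrees

/-- The standing assumptions on an edge size `r` and a degree sequence `d` on `n` vertices:
`3 ≤ r ≤ n - 3`, the degrees are positive integers, and `r` divides the sum of the degrees. -/
structure Standing {n : ℕ} (r : ℕ) (d : Fin n → ℕ) : Prop where
  three_le : 3 ≤ r
  le_sub_three : r + 3 ≤ n
  pos : ∀ j, 0 < d j
  dvd_sum : r ∣ ∑ j, d j

/-- The number of edges `e(d) = (1/r) ∑ d_j`. -/
noncomputable def numEdges {n : ℕ} (r : ℕ) (d : Fin n → ℕ) : ℝ :=
  (∑ j, (d j : ℝ)) / (r : ℝ)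

/-- The average degree `(1/n) ∑ d_j`. -/
noncomputable def avgDegree {n : ℕ} (d : Fin n → ℕ) : ℝ :=
  (∑ j, (d j : ℝ)) / (n : ℝ)

/-- `(r, d)` belongs to the first quadrant: `r ≤ n/2` and `e(d) ≤ (1/2) * C(n, r)`. -/
def FirstQuadrant {n : ℕ} (r : ℕ) (d : Fin n → ℕ) : Prop :=
  (r : ℝ) ≤ (n : ℝ) / 2 ∧ numEdges r d ≤ (1 / 2 : ℝ) * (n.choose r : ℝ)

/-- All degrees lie within a factor `exp (± Δ / r)` of the average degree. -/
def DegreesWithin {n : ℕ} (r : ℕ) (d : Fin n → ℕ) (Δ : ℝ) : Prop :=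
  ∀ j, avgDegree d * Real.exp (-Δ / (r : ℝ)) ≤ (d j : ℝ) ∧
    (d j : ℝ) ≤ avgDegree d * Real.exp (Δ / (r : ℝ))

/-- The probability `λ_W(β)` of the edge `W` in the `β`-model. -/
noncomputable def edgeProb {n : ℕ} (β : Fin n → ℝ) (W : Finset (Fin n)) : ℝ :=
  Real.exp (∑ j ∈ W, β j) / (1 + Real.exp (∑ j ∈ W, β j))

/-- `β` solves the beta-system: for every vertex `j`, the sum of `λ_W(β)` over all `r`-subsets
`W` of the vertex set that contain `j` equals `d_j`. -/
def SolvesBetaSystem {n : ℕ} (r : ℕ) (d : Fin n → ℕ) (β : Fin n → ℝ) : Prop :=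
  ∀ j, ∑ W ∈ (powersetCard r (univ : Finset (Fin n))).filter (fun W => j ∈ W),
    edgeProb β W = (d j : ℝ)

end HypergraphDegrees

namespace HypergraphDegrees

/-! The gradient of `energy` is expected degree minus prescribed degree, so a critical point solves
the beta-system. To control the spread as well, `energy` is minimized over `spreadSet n S` with `S =
K * (Δ / r)`; `exists_minimizer` supplies a minimizer by coercivity. If its spread is below `S`,
every direction is feasible and the gradient vanishes (`expDegree_eq_of_interior`).

A spread of exactly `S` is impossible for `Δ > 0`. First-order conditions bound the expected degree
above at a maximal coordinate by the upper degree bound, and below at a minimal one by the lower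
(`expDegree_le_of_max`, `le_expDegree_of_min`), so their ratio is at most `exp (2 * Δ / r)`. But
`expDegree_growth` makes this ratio at least `1 + S / 16`, a contradiction once `K > 32 * exp (2 *
Δ)`. Both halves of the theorem are instances of `exists_solution`. -/

/-- The `r`-subsets of the vertex set. -/
def edges (n r : ℕ) : Finset (Finset (Fin n)) := powersetCard r univ

/-- The expected degree of the vertex `j` in the `β`-model. -/
noncomputable def expDegree {n : ℕ} (r : ℕ) (β : Fin n → ℝ) (j : Fin n) : ℝ :=
  ∑ W ∈ (edges n r).filter (fun W => j ∈ W), edgeProb β W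

/-- The negative log-likelihood of the `β`-model. -/
noncomputable def energy {n : ℕ} (r : ℕ) (d : Fin n → ℕ) (β : Fin n → ℝ) : ℝ :=
  ∑ W ∈ edges n r, Real.log (1 + Real.exp (∑ j ∈ W, β j)) - ∑ j, (d j : ℝ) * β j

/-- The vectors whose entries differ pairwise by at most `S`. -/
def spreadSet (n : ℕ) (S : ℝ) : Set (Fin n → ℝ) := {β | ∀ j k, β j - β k ≤ S}

/-! ### Estimates for the logistic function. -/

/-- The logistic function. -/
noncomputable def logistic (x : ℝ) : ℝ := Real.exp x / (1 + Real.exp x)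

lemma logistic_pos (x : ℝ) : 0 < logistic x := by unfold logistic; positivity

lemma logistic_mono {x y : ℝ} (h : x ≤ y) : logistic x ≤ logistic y := by
  unfold logistic
  rw [div_le_div_iff₀ (by positivity) (by positivity)]
  nlinarith [Real.exp_le_exp.2 h]

lemma logistic_add_le {x y : ℝ} (h : 0 ≤ y) : logistic (x + y) ≤ Real.exp y * logistic x := by
  unfold logistic
  rw [Real.exp_add, ← mul_div_assoc, mul_comm (Real.exp y)]
  gcongr
  nlinarith [Real.one_le_exp h, Real.exp_pos x]

/-- The bound 3 keeps the denominator `1 + exp (x + t)` at most 4, the source of the 4 here. -/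
lemma logistic_add_sub {x t : ℝ} (ht : 0 ≤ t) (h : Real.exp (x + t) ≤ 3) :
    t / 4 * logistic x ≤ logistic (x + t) - logistic x := by
  have e : logistic (x + t) - logistic x =
      (Real.exp t - 1) / (1 + Real.exp (x + t)) * logistic x := by
    unfold logistic
    rw [Real.exp_add]
    field_simp
    ring
  rw [e]
  gcongr ?_ * _
  · exact (logistic_pos x).le
  · rw [div_le_div_iff₀ (by norm_num) (by positivity)]
    nlinarith [Real.add_one_le_exp t, Real.exp_pos (x + t)]

lemma edgeProb_eq_logistic {n : ℕ} (β : Fin n → ℝ) (W : Finset (Fin n)) :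
    edgeProb β W = logistic (∑ j ∈ W, β j) := rfl

/-! ### The energy, its gradient and its minimizer. -/

lemma sum_expDegree_mul {n r : ℕ} (β v : Fin n → ℝ) :
    ∑ j, v j * expDegree r β j = ∑ W ∈ edges n r, edgeProb β W * ∑ j ∈ W, v j := by
  simp only [expDegree, mul_sum, sum_filter]
  rw [sum_comm]
  refine sum_congr rfl fun W _ => ?_
  simp only [mul_ite, mul_zero]
  rw [← sum_filter]
  simp [mul_comm]

lemma sum_expDegree {n r : ℕ} (β : Fin n → ℝ) :
    ∑ j, expDegree r β j = r * ∑ W ∈ edges n r, edgeProb β W := by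
  have h := sum_expDegree_mul (r := r) β (fun _ => 1)
  simp only [one_mul] at h
  rw [h, mul_sum]
  refine sum_congr rfl fun W hW => ?_
  rw [sum_const, (mem_powersetCard.1 hW).2]
  simp [mul_comm]

lemma hasDerivAt_energy {n r : ℕ} (d : Fin n → ℕ) (β v : Fin n → ℝ) :
    HasDerivAt (fun s : ℝ => energy r d (β + s • v))
      (∑ j, v j * (expDegree r β j - d j)) 0 := by
  have h1 : ∀ w : ℝ × ℝ, HasDerivAt (fun s : ℝ => w.1 + s * w.2) w.2 0 := fun w => by
    simpa using ((hasDerivAt_id (0 : ℝ)).mul_const w.2).const_add w.1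
  have hW : ∀ W ∈ edges n r, HasDerivAt
      (fun s : ℝ => Real.log (1 + Real.exp (∑ j ∈ W, β j + s * ∑ j ∈ W, v j)))
      (edgeProb β W * ∑ j ∈ W, v j) 0 := fun W _ => by
    have := (((h1 (∑ j ∈ W, β j, ∑ j ∈ W, v j)).exp).const_add 1).log (by positivity)
    convert this using 1
    simp only [zero_mul, add_zero, edgeProb]
    ring
  have hd : ∀ j ∈ (univ : Finset (Fin n)), HasDerivAt
      (fun s : ℝ => (d j : ℝ) * (β j + s * v j)) ((d j : ℝ) * v j) 0 := fun j _ =>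
    (h1 (β j, v j)).const_mul _
  have := (HasDerivAt.fun_sum hW).sub (HasDerivAt.fun_sum hd)
  rw [← sum_expDegree_mul, ← sum_sub_distrib] at this
  refine (this.congr_deriv (sum_congr rfl fun j _ => by ring)).congr_of_eventuallyEq
    (Filter.Eventually.of_forall fun s => ?_)
  simp [energy, sum_add_distrib, mul_sum]

lemma continuous_energy {n r : ℕ} (d : Fin n → ℕ) : Continuous (energy r d) := by
  unfold energy
  refine Continuous.sub (continuous_finsetSum _ fun W _ => ?_) (by fun_prop)
  refine Continuous.log (by fun_prop) fun β => by positivity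

/-- First-order condition at a minimum in a feasible direction. -/
lemma directional_nonneg {n r : ℕ} {d : Fin n → ℕ} {A : Set (Fin n → ℝ)} {β v : Fin n → ℝ}
    (hmin : ∀ γ ∈ A, energy r d β ≤ energy r d γ)
    (hv : ∀ᶠ s in nhdsWithin (0 : ℝ) (Set.Ioi 0), β + s • v ∈ A) :
    0 ≤ ∑ j, v j * (expDegree r β j - d j) := by
  have h := (hasDerivAt_energy (r := r) d β v).hasDerivWithinAt (s := Set.Ioi 0)
  rw [hasDerivWithinAt_iff_tendsto_slope' (by simp)] at h
  refine ge_of_tendsto h ?_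
  filter_upwards [hv, self_mem_nhdsWithin] with s hs hpos
  rw [slope_def_field]
  have := hmin _ hs
  simp only [zero_smul, add_zero, sub_zero]
  exact div_nonneg (by linarith) (le_of_lt hpos)

/-- With bounded spread, one coordinate controls all the others. Each logarithm is at least both 0
and its exponent, so the energy grows linearly as `β k → -∞` (slope `D`) and as `β k → ∞` (slope `r
* N - D`); the two strict hypotheses make these slopes positive. -/
lemma exists_minimizer {n r : ℕ} {d : Fin n → ℕ} {S : ℝ} (hS : 0 ≤ S)
    (hpos : 0 < ∑ j, (d j : ℝ)) (hlt : ∑ j, (d j : ℝ) < r * (edges n r).card) :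
    ∃ β ∈ spreadSet n S, ∀ γ ∈ spreadSet n S, energy r d β ≤ energy r d γ := by
  set D := ∑ j, (d j : ℝ) with hD
  set N : ℝ := ((edges n r).card : ℝ) with hN
  have hlow : ∀ β ∈ spreadSet n S, ∀ k, (-D * β k - 2 * D * S - r * N * S ≤ energy r d β) ∧
      ((r * N - D) * β k - 2 * D * S - r * N * S ≤ energy r d β) := by
    intro β hβ k
    have h1 : ∑ j, (d j : ℝ) * β j ≤ D * β k + D * S := by
      rw [← mul_add, hD, sum_mul]
      refine sum_le_sum fun j _ => ?_
      gcongr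
      linarith [hβ j k]
    have h2 : 0 ≤ ∑ W ∈ edges n r, Real.log (1 + Real.exp (∑ j ∈ W, β j)) :=
      sum_nonneg fun W _ => Real.log_nonneg (by linarith [Real.exp_pos (∑ j ∈ W, β j)])
    have h3 : N * (r * (β k - S)) ≤
        ∑ W ∈ edges n r, Real.log (1 + Real.exp (∑ j ∈ W, β j)) := by
      rw [hN, ← nsmul_eq_mul]
      refine card_nsmul_le_sum _ _ _ fun W hW => ?_
      have h4 : (r : ℝ) * (β k - S) ≤ ∑ j ∈ W, β j := by
        rw [← (mem_powersetCard.1 hW).2, ← nsmul_eq_mul]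
        exact card_nsmul_le_sum _ _ _ fun j _ => by linarith [hβ k j]
      refine h4.trans ?_
      rw [Real.le_log_iff_exp_le (by positivity)]
      linarith
    have h5 : 0 ≤ D * S := by positivity
    have h6 : 0 ≤ r * N * S := by positivity
    unfold energy
    constructor <;> linarith
  set B : Set (Fin n → ℝ) := {β | β ∈ spreadSet n S ∧ energy r d β ≤ energy r d 0} with hB
  have hclosed : IsClosed B := by
    refine IsClosed.inter ?_ (isClosed_le (continuous_energy d) continuous_const)
    simp only [spreadSet, Set.ofPred_forall]
    exact isClosed_iInter fun j => isClosed_iInter fun k =>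
      isClosed_le (by fun_prop) continuous_const
  have hsub : B ⊆ Set.Icc (fun _ => -(energy r d 0 + 2 * D * S + r * N * S) / D)
      (fun _ => (energy r d 0 + 2 * D * S + r * N * S) / (r * N - D)) := by
    intro β hβ
    refine ⟨fun k => ?_, fun k => ?_⟩
    · have := (hlow β hβ.1 k).1
      rw [div_le_iff₀ hpos]
      linarith [hβ.2]
    · have := (hlow β hβ.1 k).2
      rw [le_div_iff₀ (by linarith)]
      linarith [hβ.2]
  have hcomp : IsCompact B := isCompact_Icc.of_isClosed_subset hclosed hsub
  obtain ⟨β, hβ, hmin⟩ := hcomp.exists_isMinOn ⟨0, by simp [hB, spreadSet, hS]⟩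
    (continuous_energy d).continuousOn
  refine ⟨β, hβ.1, fun γ hγ => ?_⟩
  by_cases h : energy r d γ ≤ energy r d 0
  · exact hmin ⟨hγ, h⟩
  · exact hβ.2.trans (le_of_lt (not_le.1 h))

/-! ### First-order conditions at the constrained minimizer. -/

/-- Moving the maximal coordinates down stays feasible. -/
lemma expDegree_le_of_max {n r : ℕ} {d : Fin n → ℕ} {S D : ℝ} {β : Fin n → ℝ}
    (hβ : β ∈ spreadSet n S) (hmin : ∀ γ ∈ spreadSet n S, energy r d β ≤ energy r d γ)
    (hd : ∀ i, (d i : ℝ) ≤ D) {j : Fin n} (hj : ∀ i, β i ≤ β j)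
    (hsymm : ∀ i, β i = β j → expDegree r β i = expDegree r β j) :
    expDegree r β j ≤ D := by
  -- All tied coordinates move together, which is feasible even when `S = 0`.
  have h := directional_nonneg (v := fun i => if β i = β j then -1 else 0) hmin (by
    have : ∀ i k, ∀ᶠ s in nhdsWithin (0 : ℝ) (Set.Ioi 0),
        (β + s • (fun i => if β i = β j then (-1 : ℝ) else 0)) i -
        (β + s • (fun i => if β i = β j then (-1 : ℝ) else 0)) k ≤ S := by
      intro i k
      have hik := hβ i k
      have hji := hβ j i
      by_cases h1 : β i = β j <;> by_cases h2 : β k = β j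
      · filter_upwards with s
        simpa [h1, h2] using hik
      · filter_upwards [self_mem_nhdsWithin] with s (hs : 0 < s)
        simp [h1, h2]
        linarith
      · have hlt : 0 < β j - β i := by
          have := lt_of_le_of_ne (hj i) h1
          linarith
        filter_upwards [Ioo_mem_nhdsGT hlt] with s hs
        simp [h1, h2]
        linarith [hs.2, hj i]
      · filter_upwards with s
        simpa [h1, h2] using hik
    simp only [spreadSet, Set.mem_ofPred_eq]
    simpa only [Filter.eventually_all] using this)
  by_contra! hlt
  refine absurd h (not_le.2 (sum_neg' (fun i _ => ?_) ⟨j, mem_univ j, ?_⟩))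
  · split_ifs with hi
    · rw [hsymm i hi]
      linarith [hd i]
    · simp
  · simp only [if_true]
    linarith [hd j]

lemma le_expDegree_of_min {n r : ℕ} {d : Fin n → ℕ} {S D : ℝ} {β : Fin n → ℝ}
    (hβ : β ∈ spreadSet n S) (hmin : ∀ γ ∈ spreadSet n S, energy r d β ≤ energy r d γ)
    (hd : ∀ i, D ≤ (d i : ℝ)) {j : Fin n} (hj : ∀ i, β j ≤ β i)
    (hsymm : ∀ i, β i = β j → expDegree r β i = expDegree r β j) :
    D ≤ expDegree r β j := by
  have h := directional_nonneg (v := fun i => if β i = β j then 1 else 0) hmin (by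
    have : ∀ i k, ∀ᶠ s in nhdsWithin (0 : ℝ) (Set.Ioi 0),
        (β + s • (fun i => if β i = β j then (1 : ℝ) else 0)) i -
        (β + s • (fun i => if β i = β j then (1 : ℝ) else 0)) k ≤ S := by
      intro i k
      have hik := hβ i k
      have hkj := hβ k j
      by_cases h1 : β i = β j <;> by_cases h2 : β k = β j
      · filter_upwards with s
        simpa [h1, h2] using hik
      · have hlt : 0 < β k - β j := by
          have := lt_of_le_of_ne (hj k) (Ne.symm h2)
          linarith
        filter_upwards [Ioo_mem_nhdsGT hlt] with s hs
        simp [h1, h2]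
        linarith [hs.2, hj k]
      · filter_upwards [self_mem_nhdsWithin] with s (hs : 0 < s)
        simp [h1, h2]
        linarith
      · filter_upwards with s
        simpa [h1, h2] using hik
    simp only [spreadSet, Set.mem_ofPred_eq]
    simpa only [Filter.eventually_all] using this)
  by_contra! hlt
  refine absurd h (not_le.2 (sum_neg' (fun i _ => ?_) ⟨j, mem_univ j, ?_⟩))
  · split_ifs with hi
    · rw [hsymm i hi]
      linarith [hd i]
    · simp
  · simp only [if_true]
    linarith [hd j]

/-- Constant shifts of either sign preserve all differences, so they are always feasible. -/
lemma sum_expDegree_eq_of_min {n r : ℕ} {d : Fin n → ℕ} {S : ℝ} {β : Fin n → ℝ}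
    (hβ : β ∈ spreadSet n S) (hmin : ∀ γ ∈ spreadSet n S, energy r d β ≤ energy r d γ) :
    ∑ j, expDegree r β j = ∑ j, (d j : ℝ) := by
  have key : ∀ a : ℝ, 0 ≤ ∑ j : Fin n, a * (expDegree r β j - d j) := fun a =>
    directional_nonneg (v := fun _ => a) hmin (by
      filter_upwards with s j k
      simpa using hβ j k)
  have h1 := key 1
  have h2 := key (-1)
  rw [← mul_sum, sum_sub_distrib] at h1 h2
  linarith

lemma expDegree_eq_of_interior {n r : ℕ} {d : Fin n → ℕ} {S : ℝ} {β : Fin n → ℝ}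
    (hβ : ∀ j k, β j - β k < S)
    (hmin : ∀ γ ∈ spreadSet n S, energy r d β ≤ energy r d γ) (i : Fin n) :
    expDegree r β i = d i := by
  have key : ∀ a : ℝ, 0 ≤ ∑ j : Fin n, (Pi.single i a : Fin n → ℝ) j * (expDegree r β j - d j) :=
    fun a => directional_nonneg hmin (by
      simp only [spreadSet, Set.mem_ofPred_eq, Filter.eventually_all]
      intro j k
      refine Filter.Eventually.filter_mono nhdsWithin_le_nhds ?_
      have hc : ContinuousAt (fun s : ℝ => (β + s • (Pi.single i a : Fin n → ℝ)) j -
          (β + s • (Pi.single i a : Fin n → ℝ)) k) 0 := by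
        simp only [Pi.add_apply, Pi.smul_apply]
        fun_prop
      filter_upwards [hc.eventually_lt_const (by simpa using hβ j k)] with s hs
      exact hs.le)
  have h1 := key 1
  have h2 := key (-1)
  simp only [Pi.single_apply, ite_mul, zero_mul, sum_ite_eq', mem_univ, if_true] at h1 h2
  linarith

/-! ### Comparing the expected degrees of two vertices. -/

/-- Edges containing both vertices cancel; exchanging `k` for `j` pairs up the remaining ones. -/
lemma expDegree_sub {n r : ℕ} (β : Fin n → ℝ) (j k : Fin n) :
    expDegree r β j - expDegree r β k =
      ∑ W ∈ (edges n r).filter (fun W => k ∈ W ∧ j ∉ W),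
        (logistic (∑ i ∈ W, β i + (β j - β k)) - logistic (∑ i ∈ W, β i)) := by
  have split : ∀ j k : Fin n, expDegree r β j =
      ∑ W ∈ (edges n r).filter (fun W => j ∈ W ∧ k ∈ W), edgeProb β W +
      ∑ W ∈ (edges n r).filter (fun W => j ∈ W ∧ k ∉ W), edgeProb β W := fun j k => by
    rw [expDegree, ← sum_filter_add_sum_filter_not _ (fun W => k ∈ W), filter_filter,
      filter_filter]
  rw [split j k, split k j, sum_sub_distrib]
  have hcomm : (edges n r).filter (fun W => j ∈ W ∧ k ∈ W) =
      (edges n r).filter (fun W => k ∈ W ∧ j ∈ W) := by simp only [and_comm]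
  have hswap : ∑ W ∈ (edges n r).filter (fun W => j ∈ W ∧ k ∉ W), edgeProb β W =
      ∑ W ∈ (edges n r).filter (fun W => k ∈ W ∧ j ∉ W),
        logistic (∑ i ∈ W, β i + (β j - β k)) := by
    refine sum_nbij' (fun W => insert k (W.erase j)) (fun W => insert j (W.erase k)) ?_ ?_ ?_ ?_ ?_
    · intro W hW
      simp only [edges, mem_filter, mem_powersetCard_univ] at hW ⊢
      obtain ⟨hc, hj, hk⟩ := hW
      have hne : j ≠ k := fun h => hk (h ▸ hj)
      rw [card_insert_of_notMem (by simp [hk]), card_erase_of_mem hj]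
      have := card_pos.2 ⟨j, hj⟩
      refine ⟨by omega, by simp, by simp [hne]⟩
    · intro W hW
      simp only [edges, mem_filter, mem_powersetCard_univ] at hW ⊢
      obtain ⟨hc, hk, hj⟩ := hW
      have hne : k ≠ j := fun h => hj (h ▸ hk)
      rw [card_insert_of_notMem (by simp [hj]), card_erase_of_mem hk]
      have := card_pos.2 ⟨k, hk⟩
      refine ⟨by omega, by simp, by simp [hne]⟩
    · intro W hW
      simp only [mem_filter] at hW
      rw [erase_insert (by simp [hW.2.2]), insert_erase hW.2.1]
    · intro W hW
      simp only [mem_filter] at hW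
      rw [erase_insert (by simp [hW.2.2]), insert_erase hW.2.1]
    · intro W hW
      simp only [mem_filter] at hW
      rw [edgeProb_eq_logistic, sum_insert (by simp [hW.2.2]), ← add_sum_erase W β hW.2.1]
      congr 1
      ring
  rw [hcomm, hswap]
  simp only [edgeProb_eq_logistic]
  ring

lemma expDegree_congr {n r : ℕ} {β : Fin n → ℝ} {j k : Fin n} (h : β j = β k) :
    expDegree r β j = expDegree r β k := by
  have := expDegree_sub (r := r) β j k
  simp only [h, sub_self, add_zero, sum_const_zero] at this
  linarith

/-- Double counting of the pairs `(W, i)` with `j, k ∈ W` and `i ∉ W`. -/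
lemma card_edges_both {n r : ℕ} {j k : Fin n} (hjk : j ≠ k) :
    ((edges n r).filter (fun W => k ∈ W ∧ j ∈ W)).card * (n - r) =
      ((edges n r).filter (fun W => k ∈ W ∧ j ∉ W)).card * (r - 1) := by
  have e1 : ((edges n r).filter (fun W => k ∈ W ∧ j ∈ W)).card * (n - r) =
      (((edges n r).filter (fun W => k ∈ W ∧ j ∈ W)).sigma (fun W => univ \ W)).card := by
    rw [card_sigma, ← smul_eq_mul, ← sum_const]
    refine sum_congr rfl fun W hW => ?_
    simp only [edges, mem_filter, mem_powersetCard_univ] at hW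
    rw [card_univ_sdiff, Fintype.card_fin, hW.1]
  have e2 : ((edges n r).filter (fun W => k ∈ W ∧ j ∉ W)).card * (r - 1) =
      (((edges n r).filter (fun W => k ∈ W ∧ j ∉ W)).sigma (fun W => W.erase k)).card := by
    rw [card_sigma, ← smul_eq_mul, ← sum_const]
    refine sum_congr rfl fun W hW => ?_
    simp only [edges, mem_filter, mem_powersetCard_univ] at hW
    rw [card_erase_of_mem hW.2.1, hW.1]
  rw [e1, e2]
  refine card_nbij' (fun p => ⟨insert p.2 (p.1.erase j), p.2⟩)
    (fun p => ⟨insert j (p.1.erase p.2), p.2⟩) ?_ ?_ ?_ ?_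
  · rintro ⟨W, i⟩ h
    simp only [coe_sigma, Set.mem_sigma_iff, mem_coe, edges, mem_filter,
      mem_powersetCard_univ, mem_sdiff, mem_univ, true_and] at h ⊢
    obtain ⟨⟨hc, hk, hj⟩, hi⟩ := h
    have hik : i ≠ k := fun h => hi (h ▸ hk)
    have hij : i ≠ j := fun h => hi (h ▸ hj)
    have := card_pos.2 ⟨j, hj⟩
    rw [card_insert_of_notMem (by simp [hi]), card_erase_of_mem hj]
    refine ⟨⟨by omega, by simp [hk, hjk.symm], by simp [hij.symm]⟩, by simp [hik]⟩
  · rintro ⟨W, i⟩ h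
    simp only [coe_sigma, Set.mem_sigma_iff, mem_coe, edges, mem_filter,
      mem_powersetCard_univ, mem_sdiff, mem_univ, true_and, mem_erase] at h ⊢
    obtain ⟨⟨hc, hk, hj⟩, hik, hi⟩ := h
    have hij : i ≠ j := fun h => hj (h ▸ hi)
    have := card_pos.2 ⟨i, hi⟩
    rw [card_insert_of_notMem (by simp [hj]), card_erase_of_mem hi]
    refine ⟨⟨by omega, by simp [hk, hik.symm], by simp⟩, by simp [hij]⟩
  · rintro ⟨W, i⟩ h
    simp only [coe_sigma, Set.mem_sigma_iff, mem_coe, mem_filter, mem_sdiff] at h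
    simp only [Sigma.mk.injEq, heq_eq_eq, and_true]
    rw [erase_insert (by simp [h.2.2]), insert_erase h.1.2.2]
  · rintro ⟨W, i⟩ h
    simp only [coe_sigma, Set.mem_sigma_iff, mem_coe, mem_filter, mem_erase] at h
    simp only [Sigma.mk.injEq, heq_eq_eq, and_true]
    rw [erase_insert (by simp [h.1.2.2]), insert_erase h.2.2]

/-- The expected degree grows with the vertex weight, at a rate proportional to the spread. -/
lemma expDegree_growth {n r : ℕ} {β : Fin n → ℝ} {j k : Fin n} {S A : ℝ}
    (hrn : r < n) (hr : 1 ≤ r) (hβ : β ∈ spreadSet n S) (hS : 0 ≤ S)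
    (hk : ∀ i, β k ≤ β i)
    (hA : A = Real.exp (r * S)) (hcard : A * (r - 1) ≤ 3 * (n - r))
    (hexp : A * Real.exp (r * β k) ≤ 3) :
    expDegree r β k * (1 + (β j - β k) / 16) ≤ expDegree r β j := by
  rcases eq_or_ne j k with rfl | hjk
  · simp
  set t := β j - β k with ht
  have ht0 : 0 ≤ t := sub_nonneg.2 (hk j)
  have hlo : ∀ W ∈ edges n r, r * β k ≤ ∑ i ∈ W, β i := fun W hW => by
    rw [← (mem_powersetCard.1 hW).2, ← nsmul_eq_mul]
    exact card_nsmul_le_sum _ _ _ fun i _ => hk i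
  have hhi : ∀ W ∈ edges n r, ∑ i ∈ W, β i ≤ r * β k + r * S := fun W hW => by
    rw [← mul_add, ← (mem_powersetCard.1 hW).2, ← nsmul_eq_mul]
    exact sum_le_card_nsmul _ _ _ fun i _ => by linarith [hβ i k]
  set X := (edges n r).filter (fun W => k ∈ W ∧ j ∉ W) with hX
  set Y := (edges n r).filter (fun W => k ∈ W ∧ j ∈ W) with hY
  set P := ∑ W ∈ X, edgeProb β W with hP
  have hsplit : expDegree r β k = ∑ W ∈ Y, edgeProb β W + P := by
    rw [expDegree, ← sum_filter_add_sum_filter_not _ (fun W => j ∈ W), filter_filter,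
      filter_filter]
  have hcount : A * Y.card ≤ 3 * X.card := by
    have h := card_edges_both (r := r) hjk
    have h' : (Y.card : ℝ) * (n - r) = X.card * (r - 1) := by
      rw [← Nat.cast_sub hrn.le, ← Nat.cast_one, ← Nat.cast_sub hr]
      exact_mod_cast h
    have hpos : (0 : ℝ) < n - r := sub_pos.2 (by exact_mod_cast hrn)
    refine le_of_mul_le_mul_right ?_ hpos
    calc A * Y.card * (n - r) = X.card * (A * (r - 1)) := by rw [mul_assoc, h']; ring
      _ ≤ X.card * (3 * (n - r)) := by gcongr
      _ = _ := by ring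
  -- `A` bounds the ratio of any two edge probabilities, so `hcount` transfers from cardinalities to
  -- probabilities. Hence `expDegree r β k ≤ 4 * P`; with the 4 of `logistic_add_sub` this gives the
  -- 16.
  have hYP : ∑ W ∈ Y, edgeProb β W ≤ 3 * P := by
    have h1 : ∑ W ∈ Y, edgeProb β W ≤ Y.card * (A * logistic (r * β k)) := by
      rw [← nsmul_eq_mul]
      refine sum_le_card_nsmul _ _ _ fun W hW => ?_
      rw [hA]
      exact (logistic_mono (hhi W (mem_filter.1 hW).1)).trans
        (logistic_add_le (by positivity))
    have h2 : X.card * logistic (r * β k) ≤ P := by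
      rw [← nsmul_eq_mul]
      exact card_nsmul_le_sum _ _ _ fun W hW => logistic_mono (hlo W (mem_filter.1 hW).1)
    nlinarith [mul_le_mul_of_nonneg_right hcount (logistic_pos (r * β k)).le]
  have hdiff : t / 4 * P ≤ expDegree r β j - expDegree r β k := by
    rw [expDegree_sub, hP, mul_sum]
    refine sum_le_sum fun W hW => logistic_add_sub ht0 ?_
    obtain ⟨hWe, hkW, hjW⟩ := mem_filter.1 hW
    -- The shifted exponent is the weight of the edge after the exchange, hence still at most `r *
    -- (β k + S)`.
    refine le_trans ?_ hexp
    rw [hA, ← Real.exp_add, Real.exp_le_exp]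
    have h1 : ∑ i ∈ W.erase k, β i ≤ (W.erase k).card • (β k + S) :=
      sum_le_card_nsmul _ _ _ fun i _ => by linarith [hβ i k]
    rw [card_erase_of_mem hkW, (mem_powersetCard.1 hWe).2, nsmul_eq_mul, Nat.cast_sub hr] at h1
    rw [← add_sum_erase W β hkW]
    push_cast at h1
    linarith [hβ j k]
  have hle : expDegree r β k ≤ 4 * P := by linarith
  nlinarith [mul_le_mul_of_nonneg_left hle ht0]

/-! ### Excluding the boundary and choosing the constants. -/

lemma exists_solution {n r : ℕ} {d : Fin n → ℕ} {Δ K : ℝ} (hst : Standing r d)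
    (hΔ : 0 ≤ Δ) (hdeg : DegreesWithin r d Δ) (hK : 32 * Real.exp (2 * Δ) < K)
    (hcard : Real.exp (K * Δ) * (r - 1) ≤ 3 * (n - r))
    (hedge : Real.exp (K * Δ) * numEdges r d ≤ 3 * (n.choose r - numEdges r d)) :
    ∃ β : Fin n → ℝ, SolvesBetaSystem r d β ∧ ∀ j k, |β j - β k| ≤ K * (Δ / (r : ℝ)) := by
  obtain ⟨hr3, hrn, hdpos, -⟩ := hst
  have hn : 0 < n := by omega
  have : Nonempty (Fin n) := ⟨⟨0, hn⟩⟩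
  have hr0 : (0 : ℝ) < r := by exact_mod_cast (by omega : 0 < r)
  have hr1 : (1 : ℝ) ≤ r := by exact_mod_cast (by omega : 1 ≤ r)
  have hK0 : 0 < K := lt_trans (by positivity) hK
  set S := K * (Δ / (r : ℝ)) with hS
  have hS0 : 0 ≤ S := by positivity
  have hrS : (r : ℝ) * S = K * Δ := by rw [hS]; field_simp
  set A := Real.exp (K * Δ) with hA
  have hA0 : 0 < A := Real.exp_pos _
  set D := ∑ j, (d j : ℝ) with hD
  have hDpos : 0 < D := sum_pos (fun j _ => by exact_mod_cast hdpos j) univ_nonempty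
  have hne : numEdges r d * r = D := by rw [numEdges]; field_simp; rfl
  have hepos : 0 < numEdges r d := by rw [numEdges]; positivity
  have hlt : numEdges r d < n.choose r := by nlinarith [mul_pos hA0 hepos]
  have hNcard : (edges n r).card = n.choose r := by simp [edges]
  obtain ⟨β, hβ, hmin⟩ := exists_minimizer (r := r) (d := d) hS0 hDpos (by
    rw [hNcard, ← hD, ← hne, mul_comm]
    gcongr)
  refine ⟨β, ?_, fun j k => abs_sub_le_iff.2 ⟨hβ j k, hβ k j⟩⟩
  change ∀ j, expDegree r β j = d j
  obtain ⟨j, hj⟩ := Finite.exists_max β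
  obtain ⟨k, hk⟩ := Finite.exists_min β
  have hsum := sum_expDegree_eq_of_min hβ hmin
  have hμj := expDegree_le_of_max hβ hmin (fun i => (hdeg i).2) hj fun i h => expDegree_congr h
  have hμk := le_expDegree_of_min hβ hmin (fun i => (hdeg i).1) hk fun i h => expDegree_congr h
  rcases lt_or_ge (β j - β k) S with hTS | hTS
  · exact expDegree_eq_of_interior
      (fun a b => lt_of_le_of_lt (sub_le_sub (hj a) (hk b)) hTS) hmin
  have hT : β j - β k = S := le_antisymm (hβ j k) hTS
  rcases hΔ.eq_or_lt with rfl | hΔpos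
  -- Here the spread bound is attained trivially: `β` and `d` are both constant, and the sum
  -- condition alone suffices.
  · have hSz : S = 0 := by simp [hS]
    have hconst : ∀ a, expDegree r β a = expDegree r β j := fun a =>
      expDegree_congr (le_antisymm (hj a) (by linarith [hk a]))
    have hdc : ∀ a, (d a : ℝ) = avgDegree d := fun a => by
      have := hdeg a
      simp only [neg_zero, zero_div, Real.exp_zero, mul_one] at this
      exact le_antisymm this.2 this.1
    intro a
    rw [hdc, hconst]
    simp only [hconst, hdc, sum_const, card_univ, Fintype.card_fin, nsmul_eq_mul] at hsum
    exact mul_left_cancel₀ (by positivity) hsum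
  · exfalso
    -- The least possible edge probability is at most the average one; this bounds `exp (r * β k)`
    -- by the odds of the edge density, which `hedge` controls.
    have hmean : (n.choose r : ℝ) * logistic (r * β k) ≤ numEdges r d := by
      rw [sum_expDegree, ← hD, ← hne, mul_comm] at hsum
      rw [← mul_right_cancel₀ hr0.ne' hsum, ← hNcard, ← nsmul_eq_mul]
      refine card_nsmul_le_sum _ _ _ fun W hW => logistic_mono ?_
      rw [← (mem_powersetCard.1 hW).2, ← nsmul_eq_mul]
      exact card_nsmul_le_sum _ _ _ fun i _ => hk i
    have hexp : A * Real.exp (r * β k) ≤ 3 := by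
      rw [logistic, ← mul_div_assoc, div_le_iff₀ (by positivity)] at hmean
      have hpos : 0 < n.choose r - numEdges r d := sub_pos.2 hlt
      refine le_of_mul_le_mul_right ?_ hpos
      calc A * Real.exp (r * β k) * (n.choose r - numEdges r d)
          = A * ((n.choose r - numEdges r d) * Real.exp (r * β k)) := by ring
        _ ≤ A * numEdges r d := by gcongr; linarith
        _ ≤ _ := hedge
    have hg := expDegree_growth (j := j) (by omega) (by omega) hβ hS0 hk
      (by rw [hA, hrS]) hcard hexp
    have havg : 0 < avgDegree d := by rw [avgDegree]; positivity
    have hμpos : 0 < expDegree r β k := lt_of_lt_of_le (by positivity) hμk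
    have hup : expDegree r β j ≤ expDegree r β k * Real.exp (2 * Δ / r) := by
      refine hμj.trans ?_
      calc avgDegree d * Real.exp (Δ / r)
          = avgDegree d * Real.exp (-Δ / r) * Real.exp (2 * Δ / r) := by
            rw [mul_assoc, ← Real.exp_add]; congr 2; ring
        _ ≤ _ := by gcongr
    have h1 : 1 + S / 16 ≤ Real.exp (2 * Δ / r) := by
      rw [← hT]
      exact le_of_mul_le_mul_left (hg.trans hup) hμpos
    have h2 : Real.exp (2 * Δ / r) ≤ 1 + 2 * Δ / r * Real.exp (2 * Δ / r) := by
      have h3 := Real.add_one_le_exp (-(2 * Δ / r))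
      have h4 : Real.exp (-(2 * Δ / r)) * Real.exp (2 * Δ / r) = 1 := by
        rw [← Real.exp_add]; simp
      nlinarith [Real.exp_pos (2 * Δ / r)]
    have h5 : Real.exp (2 * Δ / r) ≤ Real.exp (2 * Δ) :=
      Real.exp_le_exp.2 (div_le_self (by positivity) hr1)
    have hq : 0 < Δ / r := by positivity
    have h6 : 2 * Δ / r = 2 * (Δ / r) := by ring
    rw [h6] at h1 h2 h5
    nlinarith [mul_le_mul_of_nonneg_left h5 hq.le, mul_lt_mul_of_pos_left hK hq]

end HypergraphDegrees

open HypergraphDegrees in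
theorem lemma1p3 :
    (∃ Δ₀ : ℝ, 0 < Δ₀ ∧ ∃ K : ℝ, 0 < K ∧
      ∀ (n r : ℕ) (d : Fin n → ℕ) (Δ : ℝ),
        Standing r d → FirstQuadrant r d →
        0 ≤ Δ → Δ ≤ Δ₀ → DegreesWithin r d Δ →
        ∃ β : Fin n → ℝ, SolvesBetaSystem r d β ∧
          ∀ j k, |β j - β k| ≤ K * (Δ / (r : ℝ))) ∧
    (∀ c C : ℝ, 0 < c → c ≤ C →
      ∃ ε : ℝ, 0 < ε ∧ ∃ K : ℝ, 0 < K ∧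
        ∀ (n r : ℕ) (d : Fin n → ℕ) (Δ : ℝ),
          Standing r d → FirstQuadrant r d →
          (r : ℝ) * avgDegree d ≤ ε * ((n - 1).choose (r - 1) : ℝ) →
          (r : ℝ) ≤ ε * (n : ℝ) →
          c ≤ Δ → Δ ≤ C → DegreesWithin r d Δ →
          ∃ β : Fin n → ℝ, SolvesBetaSystem r d β ∧
            ∀ j k, |β j - β k| ≤ K * (Δ / (r : ℝ))) := by
  constructor
  · have hK0 : (0 : ℝ) < 32 * Real.exp 2 + 1 := by positivity
    -- `Δ₀ = 1 / K` gives `exp (K * Δ) ≤ e < 3`, and with factor 3 the two size conditions of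
    -- `exists_solution` follow from `r ≤ n / 2` and `e(d) ≤ C(n, r) / 2`.
    refine ⟨(32 * Real.exp 2 + 1)⁻¹, by positivity, 32 * Real.exp 2 + 1, hK0, ?_⟩
    intro n r d Δ hst hq h0 hΔ hdeg
    have hKΔ : (32 * Real.exp 2 + 1) * Δ ≤ 1 := by
      rwa [← le_inv_mul_iff₀ hK0, mul_one]
    have hΔ1 : Δ ≤ 1 := by nlinarith [Real.exp_pos 2]
    have hA : Real.exp ((32 * Real.exp 2 + 1) * Δ) ≤ 3 :=
      (Real.exp_le_exp.2 hKΔ).trans Real.exp_one_lt_three.le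
    have hr : (1 : ℝ) ≤ r := by exact_mod_cast (by have := hst.three_le; omega : 1 ≤ r)
    have he : 0 ≤ numEdges r d := by unfold numEdges; positivity
    obtain ⟨hq1, hq2⟩ := hq
    refine exists_solution hst h0 hdeg ?_ ?_ ?_
    · have : Real.exp (2 * Δ) ≤ Real.exp 2 := Real.exp_le_exp.2 (by linarith)
      linarith
    · nlinarith [mul_le_mul_of_nonneg_right hA (sub_nonneg.2 hr)]
    · nlinarith [mul_le_mul_of_nonneg_right hA he]
  · intro c C hc hcC
    set K := 32 * Real.exp (2 * C) + 1 with hK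
    set A := Real.exp (K * C) with hA
    have hK0 : 0 < K := by positivity
    -- `(1 + A) * x ≤ y` means `A * x ≤ y - x`, the shape of both size conditions.
    refine ⟨(1 + A)⁻¹, by positivity, K, hK0, ?_⟩
    intro n r d Δ hst _ hsparse hrn hcΔ hΔC hdeg
    have hr : (1 : ℝ) ≤ r := by exact_mod_cast (by have := hst.three_le; omega : 1 ≤ r)
    have hn0 : 0 < n := by have := hst.le_sub_three; omega
    have hn : (0 : ℝ) < n := by exact_mod_cast hn0
    have hAΔ : Real.exp (K * Δ) ≤ A := Real.exp_le_exp.2 (by gcongr)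
    have he : 0 ≤ numEdges r d := by unfold numEdges; positivity
    refine exists_solution hst (by linarith) hdeg ?_ ?_ ?_
    · have : Real.exp (2 * Δ) ≤ Real.exp (2 * C) := Real.exp_le_exp.2 (by linarith)
      linarith
    · rw [le_inv_mul_iff₀ (by positivity)] at hrn
      nlinarith [mul_le_mul_of_nonneg_right hAΔ (sub_nonneg.2 hr), Real.exp_pos (K * C)]
    · have hchoose : (n : ℝ) * ((n - 1).choose (r - 1) : ℝ) = n.choose r * r := by
        have := Nat.add_one_mul_choose_eq (n - 1) (r - 1)
        rw [Nat.sub_add_cancel hn0, Nat.sub_add_cancel (by exact_mod_cast hr)] at this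
        exact_mod_cast this
      rw [le_inv_mul_iff₀ (by positivity)] at hsparse
      have havg : (r : ℝ) * avgDegree d * n = r * r * numEdges r d := by
        unfold avgDegree numEdges
        field_simp
      -- Sparsity is rescaled from degrees to edges through `n * avgDegree d = r * numEdges r d` and
      -- `hchoose`.
      have h1 : (1 + A) * (r * numEdges r d) ≤ n.choose r := by
        refine le_of_mul_le_mul_right ?_ (by linarith : (0 : ℝ) < r)
        calc (1 + A) * (r * numEdges r d) * r
            = (1 + A) * (r * avgDegree d) * n := by rw [mul_assoc (1 + A) _ (n : ℝ), havg]; ring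
          _ ≤ ((n - 1).choose (r - 1) : ℝ) * n := by gcongr
          _ = _ := by rw [mul_comm, hchoose]
      have h2 : numEdges r d ≤ r * numEdges r d := le_mul_of_one_le_left he hr
      have hA0 : 0 < A := Real.exp_pos _
      nlinarith [mul_le_mul_of_nonneg_right hAΔ he,
        mul_le_mul_of_nonneg_left h2 (by positivity : 0 ≤ 1 + A)]
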